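/- Let $k$ be a field of characteristic $0$. Linear algebras over $k$ are vector spaces with a bilinear multiplication, not necessarily associative and without unit; homomorphisms are $k$-linear multiplicative maps. Let $E$ be an arbitrary set of identities with integer coefficients, that is, of non-associative polynomials without constant term over $\mathbb{Z}$ in countably many variables, and let $\Theta$ be the variety of all anticommutative algebras over $k$ (those with $xy=-yx$) in which $e=0$ holds identically for every $e\in E$. Assume that $\Theta$ contains a nonzero algebra. (For example, $\Theta$ may be the variety of all Lie algebras, with $E$ consisting of the Jacobi identity.) Let $\Theta^{0}$ be the category whose objects are the free algebras $F(X)$ of $\Theta$ generated by the finite subsets $X$ of a fixed countably infinite set of symbols, and whose morphisms are all homomorphisms between them. Let $\mathfrak{A}$ be the group of all automorphisms of the category $\Theta^{0}$ (functors $\Theta^0\to\Theta^0$ with a strict two-sided inverse), and let $\mathfrak{Y}$ be the normal subgroup of inner automorphisms, that is, of those that are isomorphic, as functors, to the identity functor. Then $$\mathfrak{A}/\mathfrak{Y}\cong \mathrm{Aut}\,k,$$ where $\mathrm{Aut}\,k$ is the group of all automorphisms of the field $k$. -/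

import Mathlib

open CategoryTheory

universe u

noncomputable section

namespace AnticommVariety

universe v w

/-- The linear algebra `A` over `k` (not necessarily associative, without unit) belongs to the
variety `Θ` defined, inside the variety of all anticommutative algebras, by the set `E` of
identities with integer coefficients.  An identity is a non-associative polynomial
`e = e(x₀, x₁, …)` over `ℤ`; it holds in `A` if `e(h₀, h₁, …) = 0` for all `h₀, h₁, … ∈ A`. -/
def InVariety (E : Set (FreeNonUnitalNonAssocAlgebra ℤ ℕ)) (A : Type v)
    [NonUnitalNonAssocRing A] : Prop :=
  (∀ a b : A, a * b = -(b * a)) ∧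
    ∀ e ∈ E, ∀ h : ℕ → A, FreeNonUnitalNonAssocAlgebra.lift ℤ h e = 0

section FreeAlgebra

variable (k : Type u) [Field k] (E : Set (FreeNonUnitalNonAssocAlgebra ℤ ℕ)) (X : Type v)

/-- The two-sided ideals `I` of the absolutely free algebra on `X` such that the quotient by `I`
satisfies anticommutativity and the identities in `E`. -/
structure IsVarietyIdeal (I : Submodule k (FreeNonUnitalNonAssocAlgebra k X)) : Prop where
  mul_left : ∀ a b, b ∈ I → a * b ∈ I
  mul_right : ∀ a b, a ∈ I → a * b ∈ I
  anticomm : ∀ a b, a * b + b * a ∈ I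
  identity : ∀ e ∈ E, ∀ h : ℕ → FreeNonUnitalNonAssocAlgebra k X,
    FreeNonUnitalNonAssocAlgebra.lift ℤ h e ∈ I

/-- The ideal of the absolutely free algebra on `X` generated by all the values of the defining
identities of the variety. -/
def verbalIdeal : Submodule k (FreeNonUnitalNonAssocAlgebra k X) :=
  sInf {I | IsVarietyIdeal k E X I}

theorem isVarietyIdeal_verbalIdeal : IsVarietyIdeal k E X (verbalIdeal k E X) where
  mul_left a b hb := by
    simp only [verbalIdeal, Submodule.mem_sInf, Set.mem_ofPred_eq] at hb ⊢
    exact fun I hI => hI.mul_left a b (hb I hI)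
  mul_right a b ha := by
    simp only [verbalIdeal, Submodule.mem_sInf, Set.mem_ofPred_eq] at ha ⊢
    exact fun I hI => hI.mul_right a b (ha I hI)
  anticomm a b := by
    simp only [verbalIdeal, Submodule.mem_sInf, Set.mem_ofPred_eq]
    exact fun I hI => hI.anticomm a b
  identity e he h := by
    simp only [verbalIdeal, Submodule.mem_sInf, Set.mem_ofPred_eq]
    exact fun I hI => hI.identity e he h

/-- The free algebra `F(X)` of the variety. -/
def FreeAlg : Type (max u v) :=
  FreeNonUnitalNonAssocAlgebra k X ⧸ verbalIdeal k E X

instance : AddCommGroup (FreeAlg k E X) :=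
  inferInstanceAs (AddCommGroup (FreeNonUnitalNonAssocAlgebra k X ⧸ verbalIdeal k E X))

instance : Module k (FreeAlg k E X) :=
  inferInstanceAs (Module k (FreeNonUnitalNonAssocAlgebra k X ⧸ verbalIdeal k E X))

/-- The quotient map from the absolutely free algebra, as a linear map. -/
def mk : FreeNonUnitalNonAssocAlgebra k X →ₗ[k] FreeAlg k E X :=
  (verbalIdeal k E X).mkQ

theorem mk_surjective : Function.Surjective (mk k E X) :=
  Submodule.mkQ_surjective _

theorem mk_eq_mk {a b : FreeNonUnitalNonAssocAlgebra k X} :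
    mk k E X a = mk k E X b ↔ a - b ∈ verbalIdeal k E X :=
  Submodule.Quotient.eq _

instance : Mul (FreeAlg k E X) where
  mul := Quotient.map₂ (· * ·) (by
    intro a a' ha b b' hb
    have ha' := (Submodule.quotientRel_def _).1 ha
    have hb' := (Submodule.quotientRel_def _).1 hb
    refine (Submodule.quotientRel_def _).2 ?_
    have hI := isVarietyIdeal_verbalIdeal k E X
    have := Submodule.add_mem _ (hI.mul_right _ b ha') (hI.mul_left a' _ hb')
    rwa [sub_mul, mul_sub, sub_add_sub_cancel] at this)

theorem mk_mul (a b : FreeNonUnitalNonAssocAlgebra k X) :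
    mk k E X (a * b) = mk k E X a * mk k E X b := rfl

instance : NonUnitalNonAssocRing (FreeAlg k E X) where
  left_distrib a b c := by
    obtain ⟨a, rfl⟩ := mk_surjective k E X a
    obtain ⟨b, rfl⟩ := mk_surjective k E X b
    obtain ⟨c, rfl⟩ := mk_surjective k E X c
    simp only [← map_add, ← mk_mul, mul_add]
  right_distrib a b c := by
    obtain ⟨a, rfl⟩ := mk_surjective k E X a
    obtain ⟨b, rfl⟩ := mk_surjective k E X b
    obtain ⟨c, rfl⟩ := mk_surjective k E X c
    simp only [← map_add, ← mk_mul, add_mul]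
  zero_mul a := by
    obtain ⟨a, rfl⟩ := mk_surjective k E X a
    rw [← map_zero (mk k E X), ← mk_mul, zero_mul]
  mul_zero a := by
    obtain ⟨a, rfl⟩ := mk_surjective k E X a
    rw [← map_zero (mk k E X), ← mk_mul, mul_zero]

instance : IsScalarTower k (FreeAlg k E X) (FreeAlg k E X) where
  smul_assoc r a b := by
    obtain ⟨a, rfl⟩ := mk_surjective k E X a
    obtain ⟨b, rfl⟩ := mk_surjective k E X b
    simp only [smul_eq_mul, ← map_smul, ← mk_mul, smul_mul_assoc]

instance : SMulCommClass k (FreeAlg k E X) (FreeAlg k E X) where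
  smul_comm r a b := by
    obtain ⟨a, rfl⟩ := mk_surjective k E X a
    obtain ⟨b, rfl⟩ := mk_surjective k E X b
    simp only [smul_eq_mul, ← map_smul, ← mk_mul, mul_smul_comm]

/-- `F(X)` belongs to the variety. -/
theorem inVariety_freeAlg : InVariety E (FreeAlg k E X) := by
  have hI := isVarietyIdeal_verbalIdeal k E X
  refine ⟨fun a b => ?_, fun e he h => ?_⟩
  · obtain ⟨a, rfl⟩ := mk_surjective k E X a
    obtain ⟨b, rfl⟩ := mk_surjective k E X b
    rw [← mk_mul, ← mk_mul, ← map_neg, mk_eq_mk, sub_neg_eq_add]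
    exact hI.anticomm a b
  · choose g hg using fun n => mk_surjective k E X (h n)
    let q : FreeNonUnitalNonAssocAlgebra k X →ₙₐ[ℤ] FreeAlg k E X :=
      { toFun := mk k E X
        map_smul' := fun n a => map_zsmul (mk k E X) n a
        map_zero' := map_zero _
        map_add' := map_add _
        map_mul' := mk_mul k E X }
    have hq : q.comp (FreeNonUnitalNonAssocAlgebra.lift ℤ g) =
        FreeNonUnitalNonAssocAlgebra.lift ℤ h := by
      apply FreeNonUnitalNonAssocAlgebra.hom_ext
      intro n
      simpa [q] using hg n
    rw [← hq]
    have := (mk_eq_mk k E X (a := FreeNonUnitalNonAssocAlgebra.lift ℤ g e) (b := 0)).2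
      (by simpa using hI.identity e he g)
    simpa [q] using this

/-- The free generators of `F(X)`. -/
def of (x : X) : FreeAlg k E X := mk k E X (FreeNonUnitalNonAssocAlgebra.of k x)

/-- `F(X)` is free on `X` in the variety: maps from `X` to an algebra of the variety extend
uniquely to homomorphisms. -/
theorem existsUnique_hom (A : Type w) [NonUnitalNonAssocRing A] [Module k A]
    [IsScalarTower k A A] [SMulCommClass k A A] (hA : InVariety E A) (f : X → A) :
    ∃! φ : FreeAlg k E X →ₙₐ[k] A, ∀ x, φ (of k E X x) = f x := by
  let L := FreeNonUnitalNonAssocAlgebra.lift k f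
  let l : FreeNonUnitalNonAssocAlgebra k X →ₗ[k] A :=
    { toFun := L, map_add' := map_add L, map_smul' := map_smul L }
  have hl : IsVarietyIdeal k E X (LinearMap.ker l) :=
    { mul_left := fun a b hb => by
        have hb : L b = 0 := hb
        change L (a * b) = 0
        rw [map_mul, hb, mul_zero]
      mul_right := fun a b ha => by
        have ha : L a = 0 := ha
        change L (a * b) = 0
        rw [map_mul, ha, zero_mul]
      anticomm := fun a b => by
        change L (a * b + b * a) = 0
        rw [map_add, map_mul, map_mul, hA.1 (L a) (L b), neg_add_cancel]
      identity := fun e he h => by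
        let q : FreeNonUnitalNonAssocAlgebra k X →ₙₐ[ℤ] A :=
          { toFun := L
            map_smul' := fun n a => map_zsmul L n a
            map_zero' := map_zero _
            map_add' := map_add _
            map_mul' := map_mul _ }
        have hq : q.comp (FreeNonUnitalNonAssocAlgebra.lift ℤ h) =
            FreeNonUnitalNonAssocAlgebra.lift ℤ (L ∘ h) := by
          apply FreeNonUnitalNonAssocAlgebra.hom_ext
          intro n
          simp [q]
        have := hA.2 e he (L ∘ h)
        rw [← hq] at this
        exact this }
  have hle : verbalIdeal k E X ≤ LinearMap.ker l := sInf_le hl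
  let ψ : FreeAlg k E X →ₗ[k] A := (verbalIdeal k E X).liftQ l hle
  have hψ : ∀ a, ψ (mk k E X a) = L a := fun a => rfl
  refine ⟨{ toFun := ψ
            map_smul' := map_smul ψ
            map_zero' := map_zero ψ
            map_add' := map_add ψ
            map_mul' := fun a b => ?_ }, fun x => ?_, fun φ hφ => ?_⟩
  · obtain ⟨a, rfl⟩ := mk_surjective k E X a
    obtain ⟨b, rfl⟩ := mk_surjective k E X b
    rw [← mk_mul, hψ, hψ, hψ, map_mul]
  · exact (hψ _).trans (FreeNonUnitalNonAssocAlgebra.lift_of_apply k f x)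
  · let p : FreeNonUnitalNonAssocAlgebra k X →ₙₐ[k] FreeAlg k E X :=
      { toFun := mk k E X
        map_smul' := map_smul (mk k E X)
        map_zero' := map_zero _
        map_add' := map_add _
        map_mul' := mk_mul k E X }
    have hp : φ.comp p = L := by
      apply FreeNonUnitalNonAssocAlgebra.hom_ext
      intro x
      exact (hφ x).trans (FreeNonUnitalNonAssocAlgebra.lift_of_apply k f x).symm
    ext a
    obtain ⟨a, rfl⟩ := mk_surjective k E X a
    exact (congrArg (fun g => g a) hp).trans (hψ a).symm

end FreeAlgebra

/-- The category `Θ⁰` of the free algebras of the variety `Θ` generated by the finite subsets of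
a fixed countable set of symbols, here `ℕ`.  The object with `gens = X` is `F(X)`. -/
structure FreeCat (k : Type u) [Field k] (E : Set (FreeNonUnitalNonAssocAlgebra ℤ ℕ)) where
  gens : Finset ℕ

/-- Morphisms of `Θ⁰` are all homomorphisms of algebras over `k`. -/
instance (k : Type u) [Field k] (E : Set (FreeNonUnitalNonAssocAlgebra ℤ ℕ)) :
    Category.{u} (FreeCat k E) where
  Hom A B := FreeAlg k E A.gens →ₙₐ[k] FreeAlg k E B.gens
  id A := NonUnitalAlgHom.id k (FreeAlg k E A.gens)
  comp f g := g.comp f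

end AnticommVariety

/-- The group of all automorphisms of a category `C`: functors `C ⥤ C` which have a strict
two-sided inverse functor, with composition `(Φ * Ψ)(A) = Φ(Ψ(A))`. -/
abbrev CategoryAut (C : Type*) [Category C] : Type _ := Aut (Cat.of C)

/-- The normal subgroup of inner automorphisms of a category: those which are isomorphic, as
functors, to the identity functor. -/
def innerAut (C : Type*) [Category C] : Subgroup (CategoryAut C) where
  carrier := {Φ | Nonempty (𝟭 C ≅ Φ.hom.toFunctor)}
  one_mem' := ⟨Iso.refl _⟩
  mul_mem' := by
    rintro Φ Ψ ⟨i⟩ ⟨j⟩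
    exact ⟨j ≪≫ (Functor.rightUnitor _).symm ≪≫ Functor.isoWhiskerLeft Ψ.hom.toFunctor i⟩
  inv_mem' := by
    rintro Φ ⟨i⟩
    have h : Φ.hom.toFunctor ⋙ Φ.inv.toFunctor = 𝟭 C :=
      congrArg Cat.Hom.toFunctor Φ.hom_inv_id
    exact ⟨(eqToIso h).symm ≪≫ (Functor.isoWhiskerRight i Φ.inv.toFunctor).symm ≪≫
      Functor.leftUnitor _⟩

instance innerAut_normal (C : Type*) [Category C] : (innerAut C).Normal where
  conj_mem := by
    rintro Φ ⟨i⟩ Ψ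
    have h : Ψ.inv.toFunctor ⋙ Ψ.hom.toFunctor = 𝟭 C :=
      congrArg Cat.Hom.toFunctor Ψ.inv_hom_id
    exact ⟨(eqToIso h).symm ≪≫ Functor.isoWhiskerLeft Ψ.inv.toFunctor
      ((Functor.leftUnitor _).symm ≪≫ Functor.isoWhiskerRight i Ψ.hom.toFunctor)⟩

end

/-
The free algebra on one generator represents the underlying set functor, and an equivalence `G`
sends it to a free algebra on one generator: its endomorphisms are multiplications by scalars, so
they commute, which fails for more generators.  This yields a natural bijection between the
underlying sets of `F(Y)` and `G(F(Y))`, along which derived operations correspond to derived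
operations.  Multiplications by scalars, being the endomorphisms of the free algebra on one
generator, go to multiplications by scalars, so homogeneous operations come from homogeneous
operations of the same degree.  Hence addition corresponds to addition and, since `xy` spans the
operations of degree `2` in two variables by anticommutativity, multiplication to a scalar multiple
of multiplication.  After rescaling, the bijection is semilinear over an isomorphism `σ` of the
fields.  It is unique, it is the identity exactly when `G` is isomorphic to the identity functor,
and every `σ` arises by base change.
-/

noncomputable section

namespace AnticommVariety

universe v w u'

section FreeAlgebra

variable {k : Type u} [Field k] {K : Type u'} [Field K]
  {E : Set (FreeNonUnitalNonAssocAlgebra ℤ ℕ)} {X : Type v} {Y : Type w}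

section UniversalProperty

variable {A : Type w} [NonUnitalNonAssocRing A] [Module k A] [IsScalarTower k A A]
  [SMulCommClass k A A]

/-- The homomorphism from the free algebra `F(X)` to an algebra of the variety which extends a
map on the generators. -/
def freeLift (hA : InVariety E A) (f : X → A) : FreeAlg k E X →ₙₐ[k] A :=
  (existsUnique_hom k E X A hA f).choose

@[simp]
theorem freeLift_of (hA : InVariety E A) (f : X → A) (x : X) :
    freeLift hA f (of k E X x) = f x :=
  (existsUnique_hom k E X A hA f).choose_spec.1 x

theorem freeAlg_hom_ext (hA : InVariety E A) {f g : FreeAlg k E X →ₙₐ[k] A}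
    (h : ∀ x, f (of k E X x) = g (of k E X x)) : f = g :=
  (existsUnique_hom k E X A hA fun x => g (of k E X x)).unique h fun _ => rfl

theorem of_ne_zero_of_inVariety [Nontrivial A] (hA : InVariety E A) (x : X) :
    of k E X x ≠ 0 := by
  obtain ⟨a, ha⟩ := exists_ne (0 : A)
  intro hx
  have h := freeLift_of (k := k) hA (fun _ : X => a) x
  rw [hx, map_zero] at h
  exact ha h.symm

end UniversalProperty

theorem of_ne_zero [Nontrivial (FreeAlg k E Unit)] (x : X) : of k E X x ≠ 0 :=
  of_ne_zero_of_inVariety (inVariety_freeAlg k E Unit) x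

/-- The homomorphism `F(X) → F(Y)` which substitutes `a x` for the generator `x`. -/
def subst (a : X → FreeAlg k E Y) : FreeAlg k E X →ₙₐ[k] FreeAlg k E Y :=
  freeLift (inVariety_freeAlg k E Y) a

@[simp]
theorem subst_of (a : X → FreeAlg k E Y) (x : X) : subst a (of k E X x) = a x :=
  freeLift_of _ a x

theorem eq_subst (f : FreeAlg k E X →ₙₐ[k] FreeAlg k E Y) :
    f = subst fun x => f (of k E X x) :=
  freeAlg_hom_ext (inVariety_freeAlg k E Y) fun x => (subst_of (fun x => f (of k E X x)) x).symm

theorem of_injective [Nontrivial (FreeAlg k E Unit)] : Function.Injective (of k E X) := by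
  classical
  intro x y hxy
  by_contra hne
  have h := congrArg (subst (Pi.single x (of k E X x))) hxy
  rw [subst_of, subst_of, Pi.single_eq_same, Pi.single_eq_of_ne' hne] at h
  exact of_ne_zero x h

theorem map_subst {Z : Type*} (f : FreeAlg k E Y →ₙₐ[k] FreeAlg k E Z) (a : X → FreeAlg k E Y)
    (p : FreeAlg k E X) : f (subst a p) = subst (fun x => f (a x)) p := by
  simpa using DFunLike.congr_fun (eq_subst (f.comp (subst a))) p

@[simp]
theorem subst_of_self (p : FreeAlg k E X) : subst (of k E X) p = p :=
  (DFunLike.congr_fun (eq_subst (NonUnitalAlgHom.id k (FreeAlg k E X))) p).symm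

/-- The value in `F(X)` of a non-associative word in the generators. -/
def monomial (k : Type u) [Field k] (E : Set (FreeNonUnitalNonAssocAlgebra ℤ ℕ))
    (m : FreeMagma X) : FreeAlg k E X :=
  mk k E X (MonoidAlgebra.single m 1)

theorem monomial_of (x : X) : monomial k E (FreeMagma.of x) = of k E X x := rfl

theorem monomial_mul (m n : FreeMagma X) :
    monomial k E (m * n) = monomial k E m * monomial k E n := by
  rw [monomial, monomial, monomial, ← mk_mul, MonoidAlgebra.single_mul_single, one_mul]

theorem span_range_monomial :
    Submodule.span k (Set.range (monomial k E : FreeMagma X → FreeAlg k E X)) = ⊤ := by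
  refine eq_top_iff.2 fun a _ => ?_
  obtain ⟨p, rfl⟩ := mk_surjective k E X a
  induction p using MonoidAlgebra.induction_linear with
  | zero => exact zero_mem _
  | add p q hp hq => exact map_add (mk k E X) p q ▸ add_mem (hp trivial) (hq trivial)
  | single m r =>
    have hm : mk k E X (MonoidAlgebra.single m r) = r • monomial k E m := by
      rw [monomial, ← map_smul, MonoidAlgebra.smul_single, smul_eq_mul, mul_one]
    exact hm ▸ Submodule.smul_mem _ r (Submodule.subset_span ⟨m, rfl⟩)

@[elab_as_elim]
theorem freeAlg_induction {motive : FreeAlg k E X → Prop} (of : ∀ x, motive (of k E X x))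
    (zero : motive 0) (add : ∀ a b, motive a → motive b → motive (a + b))
    (smul : ∀ (c : k) a, motive a → motive (c • a))
    (mul : ∀ a b, motive a → motive b → motive (a * b)) (a : FreeAlg k E X) : motive a := by
  have ha : a ∈ Submodule.span k (Set.range (monomial k E)) := by
    rw [span_range_monomial]; exact Submodule.mem_top
  induction ha using Submodule.span_induction with
  | mem _ hm =>
    obtain ⟨m, rfl⟩ := hm
    induction m with
    | ih1 x => exact of x
    | ih2 m n hm hn =>
      rw [monomial_mul]
      exact mul _ _ hm hn
  | zero => exact zero
  | add a b _ _ ha hb => exact add a b ha hb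
  | smul c a _ ha => exact smul c a ha

theorem InVariety.mul_self [NeZero (2 : k)] {A : Type w} [NonUnitalNonAssocRing A] [Module k A]
    (hA : InVariety E A) (a : A) : a * a = 0 := by
  have h := eq_neg_iff_add_eq_zero.1 (hA.1 a a)
  rw [← two_smul k] at h
  exact (smul_eq_zero.1 h).resolve_left two_ne_zero

section OneGenerator

variable [NeZero (2 : k)] [Unique X]

theorem exists_eq_smul_of_default (a : FreeAlg k E X) : ∃ c : k, a = c • of k E X default := by
  induction a using freeAlg_induction with
  | of x => exact ⟨1, by rw [one_smul, Unique.eq_default x]⟩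
  | zero => exact ⟨0, (zero_smul _ _).symm⟩
  | add a b ha hb =>
    obtain ⟨⟨c, rfl⟩, d, rfl⟩ := And.intro ha hb
    exact ⟨c + d, (add_smul _ _ _).symm⟩
  | smul r a ha =>
    obtain ⟨c, rfl⟩ := ha
    exact ⟨r * c, smul_smul _ _ _⟩
  | mul a b ha hb =>
    obtain ⟨⟨c, rfl⟩, d, rfl⟩ := And.intro ha hb
    refine ⟨0, ?_⟩
    rw [smul_mul_smul_comm, (inVariety_freeAlg k E X).mul_self (k := k), smul_zero, zero_smul]

theorem exists_eq_smul_of_ne_zero {a : FreeAlg k E X} (ha : a ≠ 0) (b : FreeAlg k E X) :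
    ∃ c : k, b = c • a := by
  obtain ⟨c, rfl⟩ := exists_eq_smul_of_default a
  obtain ⟨d, rfl⟩ := exists_eq_smul_of_default b
  have hc : c ≠ 0 := fun hc => ha (by rw [hc, zero_smul])
  exact ⟨d * c⁻¹, by rw [smul_smul, inv_mul_cancel_right₀ hc]⟩

theorem exists_forall_apply_eq_smul (f : FreeAlg k E X →ₙₐ[k] FreeAlg k E X) :
    ∃ c : k, ∀ a, f a = c • a := by
  obtain ⟨c, hc⟩ := exists_eq_smul_of_default (f (of k E X default))
  refine ⟨c, fun a => ?_⟩
  obtain ⟨d, rfl⟩ := exists_eq_smul_of_default a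
  rw [map_smul, hc, smul_comm]

end OneGenerator

/-- The endomorphism of `F(X)` which multiplies every generator by `r`; it multiplies the
component of degree `n` by `r ^ n`. -/
def scale (r : k) : FreeAlg k E X →ₙₐ[k] FreeAlg k E X :=
  subst fun x => r • of k E X x

theorem subst_scale (a : X → FreeAlg k E Y) (r : k) (p : FreeAlg k E X) :
    subst a (scale r p) = subst (fun x => r • a x) p := by
  simp only [scale, map_subst, map_smul, subst_of]

theorem scale_monomial (r : k) (m : FreeMagma X) :
    scale r (monomial k E m) = r ^ m.length • monomial k E m := by
  induction m with
  | ih1 x =>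
    have hx : (FreeMagma.of x).length = 1 := rfl
    rw [monomial_of, scale, subst_of, hx, pow_one]
  | ih2 m n hm hn =>
    rw [monomial_mul, map_mul, hm, hn, smul_mul_smul_comm, ← pow_add]
    rfl

theorem scale_eq_smul [NeZero (2 : k)] [Unique X] (r : k) (a : FreeAlg k E X) :
    scale r a = r • a := by
  obtain ⟨c, rfl⟩ := exists_eq_smul_of_default a
  rw [map_smul, scale, subst_of, smul_comm]

/-- An element of a free algebra is homogeneous of degree `n` if multiplying the generators by a
scalar `r` multiplies it by `r ^ n`.  Over an infinite field this is the usual notion. -/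
def IsHomogeneous (n : ℕ) (a : FreeAlg k E X) : Prop :=
  ∀ r : k, scale r a = r ^ n • a

theorem isHomogeneous_of (x : X) : IsHomogeneous 1 (of k E X x) := fun r => by
  rw [scale, subst_of, pow_one]

theorem IsHomogeneous.add {n : ℕ} {a b : FreeAlg k E X} (ha : IsHomogeneous n a)
    (hb : IsHomogeneous n b) : IsHomogeneous n (a + b) := fun r => by
  rw [map_add, ha, hb, smul_add]

theorem IsHomogeneous.mul {m n : ℕ} {a b : FreeAlg k E X} (ha : IsHomogeneous m a)
    (hb : IsHomogeneous n b) : IsHomogeneous (m + n) (a * b) := fun r => by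
  rw [map_mul, ha, hb, smul_mul_smul_comm, pow_add]

theorem exists_polynomial_eval_eq_scale {n : ℕ} (f : FreeAlg k E X →ₗ[k] k)
    (hf : ∀ m : FreeMagma X, m.length = n → f (monomial k E m) = 0) (a : FreeAlg k E X) :
    ∃ P : Polynomial k, (∀ r, P.eval r = f (scale r a)) ∧ P.coeff n = 0 := by
  have ha : a ∈ Submodule.span k (Set.range (monomial k E)) := by
    rw [span_range_monomial]; exact Submodule.mem_top
  induction ha using Submodule.span_induction with
  | mem _ hm =>
    obtain ⟨m, rfl⟩ := hm
    refine ⟨Polynomial.monomial m.length (f (monomial k E m)), fun r => ?_, ?_⟩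
    · rw [scale_monomial, map_smul, Polynomial.eval_monomial, smul_eq_mul, mul_comm]
    · rw [Polynomial.coeff_monomial]
      exact ite_eq_right_iff.2 (hf m)
  | zero => exact ⟨0, by simp⟩
  | add a b _ _ ha hb =>
    obtain ⟨⟨P, hP, hPn⟩, Q, hQ, hQn⟩ := And.intro ha hb
    exact ⟨P + Q, by simp [hP, hQ], by simp [hPn, hQn]⟩
  | smul c a _ ha =>
    obtain ⟨P, hP, hPn⟩ := ha
    exact ⟨c • P, by simp [hP], by simp [hPn]⟩

/-- If a functional `f` kills the words of length `n` but not `a`, then `f (scale r a)` is a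
polynomial in `r` without `r ^ n` term which equals `r ^ n * f a` for all `r`. -/
theorem IsHomogeneous.mem_span_monomial [Infinite k] {n : ℕ} {a : FreeAlg k E X}
    (ha : IsHomogeneous n a) :
    a ∈ Submodule.span k (monomial k E '' {m : FreeMagma X | m.length = n}) := by
  by_contra hmem
  obtain ⟨f, hfa, hf⟩ := Submodule.exists_le_ker_of_notMem hmem
  obtain ⟨P, hP, hPn⟩ := exists_polynomial_eval_eq_scale f
    (fun m hm => hf (Submodule.subset_span ⟨m, hm, rfl⟩)) a
  have hPa : P = Polynomial.monomial n (f a) := Polynomial.funext fun r => by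
    rw [hP, ha r, map_smul, Polynomial.eval_monomial, smul_eq_mul, mul_comm]
  exact hfa (by rwa [hPa, Polynomial.coeff_monomial_same] at hPn)

theorem exists_eq_of_of_length_eq_one {m : FreeMagma X} (hm : m.length = 1) :
    ∃ x, m = FreeMagma.of x := by
  cases m with
  | of x => exact ⟨x, rfl⟩
  | mul m n =>
    have := m.length_pos
    have := n.length_pos
    simp only [FreeMagma.length] at hm
    omega

theorem exists_eq_of_mul_of_of_length_eq_two {m : FreeMagma X} (hm : m.length = 2) :
    ∃ x y, m = FreeMagma.of x * FreeMagma.of y := by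
  cases m with
  | of x => simp [FreeMagma.length] at hm
  | mul m n =>
    have := m.length_pos
    have := n.length_pos
    simp only [FreeMagma.length] at hm
    obtain ⟨x, rfl⟩ := exists_eq_of_of_length_eq_one (m := m) (by omega)
    obtain ⟨y, rfl⟩ := exists_eq_of_of_length_eq_one (m := n) (by omega)
    exact ⟨x, y, rfl⟩

theorem IsHomogeneous.mem_span_range_of [Infinite k] {a : FreeAlg k E X}
    (ha : IsHomogeneous 1 a) : a ∈ Submodule.span k (Set.range (of k E X)) := by
  refine Submodule.span_mono ?_ ha.mem_span_monomial
  rintro _ ⟨m, hm, rfl⟩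
  obtain ⟨x, rfl⟩ := exists_eq_of_of_length_eq_one hm
  exact ⟨x, rfl⟩

theorem IsHomogeneous.subst_add [Infinite k] {p : FreeAlg k E X} (hp : IsHomogeneous 1 p)
    (a b : X → FreeAlg k E Y) : subst (a + b) p = subst a p + subst b p := by
  suffices h : ∀ p ∈ Submodule.span k (Set.range (of k E X)),
      subst (a + b) p = subst a p + subst b p from h p hp.mem_span_range_of
  intro p hp
  induction hp using Submodule.span_induction with
  | mem _ hx =>
    obtain ⟨x, rfl⟩ := hx
    simp only [subst_of, Pi.add_apply]
  | zero => simp only [map_zero, add_zero]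
  | add p q _ _ hp hq => rw [map_add, map_add, map_add, hp, hq, add_add_add_comm]
  | smul c p _ hp => simp only [map_smul, hp, smul_add]

theorem IsHomogeneous.exists_eq_smul_mul [Infinite k] [NeZero (2 : k)]
    {p : FreeAlg k E (Fin 2)} (hp : IsHomogeneous 2 p) :
    ∃ c : k, p = c • (of k E (Fin 2) 0 * of k E (Fin 2) 1) := by
  suffices h : p ∈ Submodule.span k {of k E (Fin 2) 0 * of k E (Fin 2) 1} by
    obtain ⟨c, hc⟩ := Submodule.mem_span_singleton.1 h
    exact ⟨c, hc.symm⟩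
  refine Submodule.span_le.2 ?_ hp.mem_span_monomial
  rintro _ ⟨m, hm, rfl⟩
  obtain ⟨x, y, rfl⟩ := exists_eq_of_mul_of_of_length_eq_two hm
  have hV := inVariety_freeAlg k E (Fin 2)
  rw [monomial_mul, monomial_of, monomial_of, SetLike.mem_coe]
  fin_cases x <;> fin_cases y
  · exact hV.mul_self (k := k) (of k E (Fin 2) 0) ▸ zero_mem _
  · exact Submodule.mem_span_singleton_self _
  · exact hV.1 (of k E (Fin 2) 1) _ ▸ neg_mem (Submodule.mem_span_singleton_self _)
  · exact hV.mul_self (k := k) (of k E (Fin 2) 1) ▸ zero_mem _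

/-- The `σ`-semilinear homomorphism between the free algebras over two fields which fixes the
generators. -/
def mapScalars (E : Set (FreeNonUnitalNonAssocAlgebra ℤ ℕ)) (X : Type v) (σ : k →+* K) :
    FreeAlg k E X →ₛₙₐ[(σ : k →* K)] FreeAlg K E X :=
  letI : Module k (FreeAlg K E X) := Module.compHom _ σ
  haveI : IsScalarTower k (FreeAlg K E X) (FreeAlg K E X) :=
    ⟨fun c a b => smul_mul_assoc (σ c) a b⟩
  haveI : SMulCommClass k (FreeAlg K E X) (FreeAlg K E X) :=
    ⟨fun c a b => (mul_smul_comm (σ c) a b).symm⟩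
  let φ : FreeAlg k E X →ₙₐ[k] FreeAlg K E X := freeLift (inVariety_freeAlg K E X) (of K E X)
  { φ with map_smul' := fun c a => map_smul φ c a }

@[simp]
theorem mapScalars_of (σ : k →+* K) (x : X) : mapScalars E X σ (of k E X x) = of K E X x := by
  let _ : Module k (FreeAlg K E X) := Module.compHom _ σ
  have : IsScalarTower k (FreeAlg K E X) (FreeAlg K E X) :=
    ⟨fun c a b => smul_mul_assoc (σ c) a b⟩
  have : SMulCommClass k (FreeAlg K E X) (FreeAlg K E X) :=
    ⟨fun c a b => (mul_smul_comm (σ c) a b).symm⟩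
  exact freeLift_of (k := k) (inVariety_freeAlg K E X) (of K E X) x

theorem mapScalars_smul (σ : k →+* K) (c : k) (a : FreeAlg k E X) :
    mapScalars E X σ (c • a) = σ c • mapScalars E X σ a :=
  map_smulₛₗ (mapScalars E X σ) c a

theorem mapScalars_subst (σ : k →+* K) (a : X → FreeAlg k E Y) (p : FreeAlg k E X) :
    mapScalars E Y σ (subst a p) =
      subst (fun x => mapScalars E Y σ (a x)) (mapScalars E X σ p) := by
  induction p using freeAlg_induction with
  | of x => simp only [subst_of, mapScalars_of]
  | zero => simp only [map_zero]
  | add p q hp hq => simp only [map_add, hp, hq]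
  | smul c p hp => simp only [map_smul, mapScalars_smul, hp]
  | mul p q hp hq => simp only [map_mul, hp, hq]

theorem mapScalars_leftInverse {σ : k →+* K} {τ : K →+* k} (h : Function.LeftInverse τ σ) :
    Function.LeftInverse (mapScalars E X τ) (mapScalars E X σ) := by
  intro a
  induction a using freeAlg_induction with
  | of x => simp only [mapScalars_of]
  | zero => simp only [map_zero]
  | add a b ha hb => simp only [map_add, ha, hb]
  | smul c a ha => rw [mapScalars_smul, mapScalars_smul, ha, h c]
  | mul a b ha hb => simp only [map_mul, ha, hb]

end FreeAlgebra

section Category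

variable {k : Type u} [Field k] {K : Type u'} [Field K] {L : Type*} [Field L]
  {E E' E'' : Set (FreeNonUnitalNonAssocAlgebra ℤ ℕ)}

instance : ConcreteCategory (FreeCat k E)
    (fun Y Z => FreeAlg k E Y.gens →ₙₐ[k] FreeAlg k E Z.gens) where
  hom f := f
  ofHom f := f

namespace FreeCat

variable {X Y Z : FreeCat k E}

/-- The morphism of `Θ⁰` which substitutes `a y` for the generator `y`. -/
def substHom (a : Y.gens → FreeAlg k E Z.gens) : Y ⟶ Z :=
  ConcreteCategory.ofHom (subst a)

@[simp]
theorem substHom_apply (a : Y.gens → FreeAlg k E Z.gens) (p : FreeAlg k E Y.gens) :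
    substHom a p = subst a p := rfl

theorem hom_ext {f g : Y ⟶ Z} (h : ∀ y, f (of k E Y.gens y) = g (of k E Y.gens y)) : f = g :=
  ConcreteCategory.ext (freeAlg_hom_ext (inVariety_freeAlg k E Z.gens) h)

/-- An algebra freely generated by one element represents the underlying set functor. -/
def homEquiv [Unique X.gens] : (X ⟶ Y) ≃ FreeAlg k E Y.gens where
  toFun f := f (of k E X.gens default)
  invFun a := substHom fun _ => a
  left_inv f := hom_ext fun y => by rw [substHom_apply, subst_of, Unique.eq_default y]
  right_inv a := subst_of (fun _ => a) default

theorem homEquiv_comp [Unique X.gens] (f : X ⟶ Y) (g : Y ⟶ Z) :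
    homEquiv (f ≫ g) = g (homEquiv f) :=
  ConcreteCategory.comp_apply f g _

theorem homEquiv_symm_apply [Unique X.gens] (f : Y ⟶ Z) (a : FreeAlg k E Y.gens) :
    (homEquiv.symm (f a) : X ⟶ Z) = homEquiv.symm a ≫ f := by
  rw [Equiv.symm_apply_eq, homEquiv_comp, Equiv.apply_symm_apply]

theorem exists_equiv_gens (k : Type u) [Field k] (E : Set (FreeNonUnitalNonAssocAlgebra ℤ ℕ))
    (ι : Type*) [Finite ι] : ∃ P : FreeCat k E, Nonempty (P.gens ≃ ι) :=
  ⟨⟨Finset.range (Nat.card ι)⟩, Finite.card_eq.1 (by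
    rw [Nat.card_eq_fintype_card, Fintype.card_coe, Finset.card_range])⟩

theorem exists_unique_gens (k : Type u) [Field k] (E : Set (FreeNonUnitalNonAssocAlgebra ℤ ℕ)) :
    ∃ X : FreeCat k E, Nonempty (Unique X.gens) :=
  let ⟨X, ⟨e⟩⟩ := exists_equiv_gens k E Unit
  ⟨X, ⟨e.unique⟩⟩

theorem ext_subst {ι : Type*} [Finite ι] {p q : FreeAlg k E ι}
    (h : ∀ (Y : FreeCat k E) (a : ι → FreeAlg k E Y.gens), subst a p = subst a q) : p = q := by
  obtain ⟨P, ⟨e⟩⟩ := exists_equiv_gens k E ι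
  simpa [map_subst] using
    congrArg (subst fun y => of k E ι (e y)) (h P fun i => of k E P.gens (e.symm i))

theorem endomorphisms_comm [NeZero (2 : k)] [Unique X.gens] (f g : X ⟶ X) : f ≫ g = g ≫ f := by
  obtain ⟨c, hc⟩ := exists_forall_apply_eq_smul (ConcreteCategory.hom f)
  obtain ⟨d, hd⟩ := exists_forall_apply_eq_smul (ConcreteCategory.hom g)
  refine hom_ext fun x => ?_
  rw [ConcreteCategory.comp_apply, ConcreteCategory.comp_apply, hc, hd, hc, hd, smul_comm]

theorem subsingleton_gens_of_comm [Nontrivial (FreeAlg k E Unit)]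
    (h : ∀ f g : X ⟶ X, f ≫ g = g ≫ f) : Subsingleton X.gens := by
  refine ⟨fun i j => of_injective (k := k) (E := E) ?_⟩
  have hij := h (substHom fun _ => of k E X.gens j) (substHom fun _ => of k E X.gens i)
  simpa using ConcreteCategory.congr_hom hij (of k E X.gens i)

theorem nonempty_gens_of_hom_ne {f g : X ⟶ X} (h : f ≠ g) : Nonempty X.gens := by
  by_contra hX
  rw [not_nonempty_iff] at hX
  exact h (hom_ext isEmptyElim)

end FreeCat

/-- A natural bijection between the underlying sets of `F(Y)` and of `G(F(Y))`. -/
structure UnderlyingIso (G : FreeCat k E ⥤ FreeCat K E') where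
  equiv (Y : FreeCat k E) : FreeAlg k E Y.gens ≃ FreeAlg K E' (G.obj Y).gens
  naturality {Y Z : FreeCat k E} (f : Y ⟶ Z) (a : FreeAlg k E Y.gens) :
    equiv Z (f a) = G.map f (equiv Y a)

section Functor

variable {G : FreeCat k E ⥤ FreeCat K E'}

open FreeCat

theorem nonempty_unique_gens [NeZero (2 : k)] [Nontrivial (FreeAlg k E Unit)]
    [Nontrivial (FreeAlg K E' Unit)] [G.Full] [G.Faithful] (X : FreeCat k E) [Unique X.gens] :
    Nonempty (Unique (G.obj X).gens) := by
  have hsub : Subsingleton (G.obj X).gens := subsingleton_gens_of_comm fun f g => by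
    rw [← G.map_preimage f, ← G.map_preimage g, ← G.map_comp, ← G.map_comp, endomorphisms_comm]
  have hne : (𝟙 X : X ⟶ X) ≠ substHom 0 := fun h =>
    of_ne_zero (k := k) (E := E) (default : X.gens) (by
      simpa using ConcreteCategory.congr_hom h (of k E X.gens default))
  obtain ⟨i⟩ := nonempty_gens_of_hom_ne (G.map_injective.ne hne)
  exact ⟨uniqueOfSubsingleton i⟩

theorem nonempty_underlyingIso [NeZero (2 : k)] [Nontrivial (FreeAlg k E Unit)]
    [Nontrivial (FreeAlg K E' Unit)] (G : FreeCat k E ⥤ FreeCat K E') [G.Full] [G.Faithful] :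
    Nonempty (UnderlyingIso G) := by
  obtain ⟨X, ⟨_⟩⟩ := exists_unique_gens k E
  obtain ⟨_⟩ := nonempty_unique_gens (G := G) X
  let e (Y : FreeCat k E) : (X ⟶ Y) ≃ (G.obj X ⟶ G.obj Y) :=
    (Functor.FullyFaithful.ofFullyFaithful G).homEquiv
  refine ⟨⟨fun Y => homEquiv.symm.trans ((e Y).trans homEquiv), fun {Y Z} f a => ?_⟩⟩
  change homEquiv (G.map (homEquiv.symm (f a))) = G.map f (homEquiv (G.map (homEquiv.symm a)))
  rw [homEquiv_symm_apply, G.map_comp, homEquiv_comp]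

namespace UnderlyingIso

variable (t : UnderlyingIso G)

theorem equiv_zero (Y : FreeCat k E) : t.equiv Y 0 = 0 := by
  obtain ⟨a, ha⟩ := (t.equiv Y).surjective 0
  let zeroHom : Y ⟶ Y := ConcreteCategory.ofHom (0 : FreeAlg k E Y.gens →ₙₐ[k] FreeAlg k E Y.gens)
  calc t.equiv Y 0 = G.map zeroHom (t.equiv Y a) := t.naturality zeroHom a
    _ = 0 := by rw [ha, map_zero]

theorem equiv_ne_zero {Y : FreeCat k E} {a : FreeAlg k E Y.gens} (ha : a ≠ 0) :
    t.equiv Y a ≠ 0 :=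
  t.equiv_zero Y ▸ (t.equiv Y).injective.ne ha

theorem exists_mulEquiv_equiv_smul [NeZero (2 : k)] [NeZero (2 : K)]
    [Nontrivial (FreeAlg k E Unit)] [Nontrivial (FreeAlg K E' Unit)] [G.Full] [G.Faithful] :
    ∃ φ : k ≃* K, ∀ Y (c : k) (a : FreeAlg k E Y.gens),
      t.equiv Y (c • a) = φ c • t.equiv Y a := by
  obtain ⟨X, ⟨_⟩⟩ := exists_unique_gens k E
  obtain ⟨_⟩ := nonempty_unique_gens (G := G) X
  set x := of k E X.gens default
  have hx : x ≠ 0 := of_ne_zero _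
  have htx : t.equiv X x ≠ 0 := t.equiv_ne_zero hx
  choose φ hφ using fun c : k => exists_eq_smul_of_ne_zero htx (t.equiv X (c • x))
  have hsmul (Y) (c : k) (a : FreeAlg k E Y.gens) : t.equiv Y (c • a) = φ c • t.equiv Y a := by
    have ha : (homEquiv.symm a : X ⟶ Y) x = a := homEquiv.apply_symm_apply a
    rw [← ha, ← map_smul, t.naturality, hφ, map_smul, t.naturality]
  have hmul (c d : k) : φ (c * d) = φ c * φ d := smul_left_injective K htx (by
    simp only [← hsmul, mul_smul])
  have hinj : Function.Injective φ := fun c d hcd => smul_left_injective k hx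
    ((t.equiv X).injective (by simp only [hsmul, hcd]))
  have hsurj : Function.Surjective φ := fun d => by
    obtain ⟨a, ha⟩ := (t.equiv X).surjective (d • t.equiv X x)
    obtain ⟨c, rfl⟩ := exists_eq_smul_of_default a
    exact ⟨c, smul_left_injective K htx ((hsmul X c x).symm.trans ha)⟩
  exact ⟨MulEquiv.ofBijective (MulHom.mk φ hmul) ⟨hinj, hsurj⟩, hsmul⟩

/-- An element of a free algebra is the same thing as a derived operation, which a natural bijection
carries over. -/
theorem exists_equiv_subst_eq {ι : Type*} [Finite ι] (q : FreeAlg K E' ι) :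
    ∃ p : FreeAlg k E ι, ∀ Y (a : ι → FreeAlg k E Y.gens),
      t.equiv Y (subst a p) = subst (fun i => t.equiv Y (a i)) q := by
  obtain ⟨P, ⟨e⟩⟩ := exists_equiv_gens k E ι
  let x (i : ι) : FreeAlg k E P.gens := of k E P.gens (e.symm i)
  let p := (t.equiv P).symm (subst (fun i => t.equiv P (x i)) q)
  refine ⟨subst (fun y => of k E ι (e y)) p, fun Y a => ?_⟩
  let f : P ⟶ Y := substHom fun y => a (e y)
  have hfx (i : ι) : f (x i) = a i := by simp [f, x]
  calc t.equiv Y (subst a (subst (fun y => of k E ι (e y)) p))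
      = t.equiv Y (f p) := by simp only [map_subst, subst_of, f, substHom_apply]
    _ = G.map f (subst (fun i => t.equiv P (x i)) q) := by
      rw [t.naturality, Equiv.apply_symm_apply]
    _ = subst (fun i => t.equiv Y (a i)) q := by simp only [map_subst, ← t.naturality, hfx]

theorem isHomogeneous_of_equiv_subst {φ : k →* K}
    (hφ : ∀ Y (c : k) (a : FreeAlg k E Y.gens), t.equiv Y (c • a) = φ c • t.equiv Y a)
    {ι : Type*} [Finite ι] {p : FreeAlg k E ι} {q : FreeAlg K E' ι}
    (hpq : ∀ Y (a : ι → FreeAlg k E Y.gens),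
      t.equiv Y (subst a p) = subst (fun i => t.equiv Y (a i)) q)
    {n : ℕ} (hq : IsHomogeneous n q) : IsHomogeneous n p := by
  intro r
  refine ext_subst fun Y a => (t.equiv Y).injective ?_
  calc t.equiv Y (subst a (scale r p)) = t.equiv Y (subst (fun i => r • a i) p) := by
        rw [subst_scale]
    _ = subst (fun i => φ r • t.equiv Y (a i)) q := by simp only [hpq, hφ]
    _ = φ r ^ n • subst (fun i => t.equiv Y (a i)) q := by rw [← subst_scale, hq, map_smul]
    _ = t.equiv Y (subst a (r ^ n • p)) := by rw [map_smul, hφ, hpq, map_pow]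

theorem equiv_add [Infinite k] {φ : k →* K}
    (hφ : ∀ Y (c : k) (a : FreeAlg k E Y.gens), t.equiv Y (c • a) = φ c • t.equiv Y a)
    (Y : FreeCat k E) (a b : FreeAlg k E Y.gens) :
    t.equiv Y (a + b) = t.equiv Y a + t.equiv Y b := by
  obtain ⟨p, hp⟩ := t.exists_equiv_subst_eq (of K E' (Fin 2) 0 + of K E' (Fin 2) 1)
  have hp1 : IsHomogeneous 1 p :=
    t.isHomogeneous_of_equiv_subst hφ hp ((isHomogeneous_of 0).add (isHomogeneous_of 1))
  have hsum (a b : FreeAlg k E Y.gens) :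
      t.equiv Y (subst ![a, b] p) = t.equiv Y a + t.equiv Y b := by
    rw [hp, map_add, subst_of, subst_of]
    rfl
  have hleft : subst ![a, 0] p = a := (t.equiv Y).injective (by rw [hsum, equiv_zero, add_zero])
  have hright : subst ![0, b] p = b := (t.equiv Y).injective (by rw [hsum, equiv_zero, zero_add])
  calc t.equiv Y (a + b) = t.equiv Y (subst (![a, 0] + ![0, b]) p) := by
        rw [hp1.subst_add, hleft, hright]
    _ = t.equiv Y a + t.equiv Y b := by simp [hsum]

theorem exists_equiv_smul_mul [Infinite k] [NeZero (2 : k)] {φ : k →* K}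
    (hφ : ∀ Y (c : k) (a : FreeAlg k E Y.gens), t.equiv Y (c • a) = φ c • t.equiv Y a) :
    ∃ c : k, ∀ Y (a b : FreeAlg k E Y.gens),
      t.equiv Y (c • (a * b)) = t.equiv Y a * t.equiv Y b := by
  obtain ⟨p, hp⟩ := t.exists_equiv_subst_eq (of K E' (Fin 2) 0 * of K E' (Fin 2) 1)
  have hp2 : IsHomogeneous 2 p :=
    t.isHomogeneous_of_equiv_subst hφ hp ((isHomogeneous_of 0).mul (isHomogeneous_of 1))
  obtain ⟨c, rfl⟩ := hp2.exists_eq_smul_mul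
  exact ⟨c, fun Y a b => by simpa using hp Y ![a, b]⟩

theorem exists_ringEquiv_equiv_smul [Infinite k] [NeZero (2 : k)] [NeZero (2 : K)]
    [Nontrivial (FreeAlg k E Unit)] [Nontrivial (FreeAlg K E' Unit)] [G.Full] [G.Faithful] :
    ∃ σ : k ≃+* K, ∀ Y (c : k) (a : FreeAlg k E Y.gens),
      t.equiv Y (c • a) = σ c • t.equiv Y a := by
  obtain ⟨φ, hφ⟩ := t.exists_mulEquiv_equiv_smul
  obtain ⟨X, ⟨_⟩⟩ := exists_unique_gens k E
  have hx : t.equiv X (of k E X.gens default) ≠ 0 := t.equiv_ne_zero (of_ne_zero _)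
  have hadd (c d : k) : φ (c + d) = φ c + φ d := smul_left_injective K hx (by
    simp only [add_smul, ← hφ, ← t.equiv_add (φ := (φ : k →* K)) hφ])
  exact ⟨{ φ with map_add' := hadd }, hφ⟩

/-- A natural bijection multiplied by a nonzero scalar. -/
def rescale (r : Kˣ) : UnderlyingIso G where
  equiv Y := (t.equiv Y).trans (MulAction.toPerm r)
  naturality f a := by
    simp only [Equiv.trans_apply, MulAction.toPerm_apply, Units.smul_def, t.naturality, map_smul]

theorem rescale_apply (r : Kˣ) (Y : FreeCat k E) (a : FreeAlg k E Y.gens) :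
    (t.rescale r).equiv Y a = (r : K) • t.equiv Y a := rfl

end UnderlyingIso

end Functor

/-- A natural bijection between the underlying sets of `F(Y)` and of `G(F(Y))` which is a
`σ`-semilinear isomorphism of algebras for every `Y`. -/
structure SemilinearIso (σ : k ≃+* K) (G : FreeCat k E ⥤ FreeCat K E') extends
    UnderlyingIso G where
  equiv_add (Y : FreeCat k E) (a b : FreeAlg k E Y.gens) : equiv Y (a + b) = equiv Y a + equiv Y b
  equiv_mul (Y : FreeCat k E) (a b : FreeAlg k E Y.gens) : equiv Y (a * b) = equiv Y a * equiv Y b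
  equiv_smul (Y : FreeCat k E) (c : k) (a : FreeAlg k E Y.gens) :
    equiv Y (c • a) = σ c • equiv Y a

namespace SemilinearIso

open FreeCat

section Basic

variable {σ τ : k ≃+* K} {G : FreeCat k E ⥤ FreeCat K E'}

/-- The composite of semilinear isomorphisms for composable functors. -/
def trans {ρ : K ≃+* L} {H : FreeCat K E' ⥤ FreeCat L E''} (t : SemilinearIso σ G)
    (s : SemilinearIso ρ H) : SemilinearIso (σ.trans ρ) (G ⋙ H) where
  equiv Y := (t.equiv Y).trans (s.equiv (G.obj Y))
  naturality f a := by simp [t.naturality, s.naturality]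
  equiv_add Y a b := by simp [t.equiv_add, s.equiv_add]
  equiv_mul Y a b := by simp [t.equiv_mul, s.equiv_mul]
  equiv_smul Y c a := by simp [t.equiv_smul, s.equiv_smul]

theorem ringEquiv_unique [NeZero (2 : k)] [Nontrivial (FreeAlg k E Unit)]
    (t : SemilinearIso σ G) (s : SemilinearIso τ G) : σ = τ := by
  obtain ⟨X, ⟨_⟩⟩ := exists_unique_gens k E
  have hx : t.equiv X (of k E X.gens default) ≠ 0 := t.equiv_ne_zero (of_ne_zero _)
  have hscale {ρ : k ≃+* K} (u : SemilinearIso ρ G) (c : k) (b) :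
      G.map (ConcreteCategory.ofHom (scale c) : X ⟶ X) b = ρ c • b := by
    obtain ⟨a, rfl⟩ := (u.equiv X).surjective b
    rw [← u.naturality, ← u.equiv_smul, ConcreteCategory.hom_ofHom, scale_eq_smul]
  exact RingEquiv.ext fun c => smul_left_injective K hx ((hscale t c _).symm.trans (hscale s c _))

end Basic

variable {G : FreeCat k E ⥤ FreeCat k E}

/-- The isomorphism of functors given by a linear isomorphism. -/
def toNatIso (t : SemilinearIso (RingEquiv.refl k) G) : 𝟭 (FreeCat k E) ≅ G :=
  let f (Y : FreeCat k E) : FreeAlg k E Y.gens →ₙₐ[k] FreeAlg k E (G.obj Y).gens :=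
    { toFun := t.equiv Y
      map_smul' := t.equiv_smul Y
      map_zero' := t.equiv_zero Y
      map_add' := t.equiv_add Y
      map_mul' := t.equiv_mul Y }
  let g (Y : FreeCat k E) := (f Y).inverse (t.equiv Y).symm (t.equiv Y).left_inv
    (t.equiv Y).right_inv
  NatIso.ofComponents
    (fun Y =>
      { hom := ConcreteCategory.ofHom (f Y)
        inv := ConcreteCategory.ofHom (g Y)
        hom_inv_id := ConcreteCategory.ext_apply (t.equiv Y).symm_apply_apply
        inv_hom_id := ConcreteCategory.ext_apply (t.equiv Y).apply_symm_apply })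
    fun f => ConcreteCategory.ext_apply (t.naturality f)

/-- The linear isomorphism given by an isomorphism of functors. -/
def ofNatIso (i : 𝟭 (FreeCat k E) ≅ G) : SemilinearIso (RingEquiv.refl k) G where
  equiv Y :=
    { toFun := i.hom.app Y
      invFun := i.inv.app Y
      left_inv := ConcreteCategory.congr_hom (i.hom_inv_id_app Y)
      right_inv := ConcreteCategory.congr_hom (i.inv_hom_id_app Y) }
  naturality f := ConcreteCategory.congr_hom (i.hom.naturality f)
  equiv_add Y := map_add (ConcreteCategory.hom (i.hom.app Y))
  equiv_mul Y := map_mul (ConcreteCategory.hom (i.hom.app Y))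
  equiv_smul Y := map_smul (ConcreteCategory.hom (i.hom.app Y))

end SemilinearIso

theorem mul_eq_zero_of_isEquivalence [Infinite K] [NeZero (2 : k)] [NeZero (2 : K)]
    [Nontrivial (FreeAlg k E Unit)] [Nontrivial (FreeAlg K E' Unit)]
    {G : FreeCat k E ⥤ FreeCat K E'} [G.IsEquivalence]
    (h : ∀ Y, ∀ a b : FreeAlg K E' (G.obj Y).gens, a * b = 0) (Y : FreeCat k E)
    (a b : FreeAlg k E Y.gens) : a * b = 0 := by
  obtain ⟨s⟩ := nonempty_underlyingIso G.inv
  obtain ⟨φ, hφ⟩ := s.exists_mulEquiv_equiv_smul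
  obtain ⟨c, hc⟩ := s.exists_equiv_smul_mul (φ := (φ : K →* k)) hφ
  have hinv (Z) (a b : FreeAlg k E (G.inv.obj (G.obj Z)).gens) : a * b = 0 := by
    obtain ⟨a, rfl⟩ := (s.equiv (G.obj Z)).surjective a
    obtain ⟨b, rfl⟩ := (s.equiv (G.obj Z)).surjective b
    rw [← hc, h, smul_zero, s.equiv_zero]
  let unit : Y ⟶ G.inv.obj (G.obj Y) := G.asEquivalence.unitIso.hom.app Y
  have : IsIso unit := inferInstanceAs (IsIso (G.asEquivalence.unitIso.hom.app Y))
  refine (ConcreteCategory.bijective_of_isIso unit).injective ?_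
  rw [map_mul, hinv, map_zero]

theorem exists_semilinearIso [Infinite k] [Infinite K] [NeZero (2 : k)] [NeZero (2 : K)]
    [Nontrivial (FreeAlg k E Unit)] [Nontrivial (FreeAlg K E' Unit)]
    (G : FreeCat k E ⥤ FreeCat K E') [G.IsEquivalence] :
    ∃ σ : k ≃+* K, Nonempty (SemilinearIso σ G) := by
  obtain ⟨t⟩ := nonempty_underlyingIso G
  obtain ⟨σ, hσ⟩ := t.exists_ringEquiv_equiv_smul
  have hadd := t.equiv_add (φ := (σ : k →* K)) hσ
  obtain ⟨c, hc⟩ := t.exists_equiv_smul_mul (φ := (σ : k →* K)) hσ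
  refine ⟨σ, ?_⟩
  rcases eq_or_ne c 0 with rfl | hc0
  · have hmul' (Y) (a b : FreeAlg K E' (G.obj Y).gens) : a * b = 0 := by
      obtain ⟨a, rfl⟩ := (t.equiv Y).surjective a
      obtain ⟨b, rfl⟩ := (t.equiv Y).surjective b
      rw [← hc, zero_smul, t.equiv_zero]
    have hmul := mul_eq_zero_of_isEquivalence hmul'
    exact ⟨{ t with
      equiv_add := hadd
      equiv_mul := fun Y a b => by rw [hmul, hmul', t.equiv_zero]
      equiv_smul := hσ }⟩
  · have hmul (Y) (a b : FreeAlg k E Y.gens) :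
        t.equiv Y a * t.equiv Y b = σ c • t.equiv Y (a * b) := by rw [← hc, hσ]
    let r : Kˣ := (Units.mk0 (σ c) ((map_ne_zero σ).2 hc0))⁻¹
    have hr : (r : K) * σ c = 1 := Units.inv_mul (Units.mk0 (σ c) _)
    exact ⟨{ t.rescale r with
      equiv_add := fun Y a b => by simp only [t.rescale_apply, hadd, smul_add]
      equiv_mul := fun Y a b => by
        simp only [t.rescale_apply, smul_mul_smul_comm, hmul, smul_smul, mul_assoc, hr, mul_one]
      equiv_smul := fun Y d a => by simp only [t.rescale_apply, hσ, smul_comm (r : K)] }⟩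

theorem mapScalars_hom_apply (σ : k →+* K) {Y Z : FreeCat k E} (f : Y ⟶ Z)
    (a : FreeAlg k E Y.gens) :
    mapScalars E Z.gens σ (f a) =
      subst (fun y => mapScalars E Z.gens σ (f (of k E Y.gens y))) (mapScalars E Y.gens σ a) := by
  rw [← mapScalars_subst, ← map_subst (ConcreteCategory.hom f), subst_of_self]

/-- Base change along a homomorphism of fields. -/
def scalarExtension (E : Set (FreeNonUnitalNonAssocAlgebra ℤ ℕ)) (σ : k →+* K) :
    FreeCat k E ⥤ FreeCat K E where
  obj Y := ⟨Y.gens⟩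
  map {Y Z} f := FreeCat.substHom fun y => mapScalars E Z.gens σ (f (of k E Y.gens y))
  map_id Y := FreeCat.hom_ext fun y => by
    simp only [FreeCat.substHom_apply, subst_of, ConcreteCategory.id_apply, mapScalars_of]
  map_comp f g := FreeCat.hom_ext fun y => by
    simp only [FreeCat.substHom_apply, subst_of, ConcreteCategory.comp_apply]
    exact mapScalars_hom_apply σ g _

theorem scalarExtension_map_of (σ : k →+* K) {Y Z : FreeCat k E} (f : Y ⟶ Z) (y : Y.gens) :
    (scalarExtension E σ).map f (of K E Y.gens y) =
      mapScalars E Z.gens σ (f (of k E Y.gens y)) :=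
  subst_of _ y

theorem scalarExtension_comp_eq_id {σ : k →+* K} {τ : K →+* k} (h : Function.LeftInverse τ σ) :
    scalarExtension E σ ⋙ scalarExtension E τ = 𝟭 (FreeCat k E) :=
  CategoryTheory.Functor.hext (fun _ => rfl) fun _ _ f => heq_of_eq <| FreeCat.hom_ext fun y =>
    ((scalarExtension_map_of τ ((scalarExtension E σ).map f) y).trans
      (congrArg _ (scalarExtension_map_of σ f y))).trans (mapScalars_leftInverse h _)

/-- The semilinear bijections `F(Y) → F(Y)` which fix the generators. -/
def scalarExtensionIso (E : Set (FreeNonUnitalNonAssocAlgebra ℤ ℕ)) (σ : k ≃+* K) :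
    SemilinearIso σ (scalarExtension E (σ : k →+* K)) where
  equiv Y :=
    { toFun := mapScalars E Y.gens (σ : k →+* K)
      invFun := mapScalars E Y.gens (σ.symm : K →+* k)
      left_inv := mapScalars_leftInverse σ.symm_apply_apply
      right_inv := mapScalars_leftInverse σ.apply_symm_apply }
  naturality f a := mapScalars_hom_apply (σ : k →+* K) f a
  equiv_add Y a b := map_add (mapScalars E Y.gens (σ : k →+* K)) a b
  equiv_mul Y a b := map_mul (mapScalars E Y.gens (σ : k →+* K)) a b
  equiv_smul _ c a := mapScalars_smul (σ : k →+* K) c a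

/-- Base change along an automorphism of the field, as an automorphism of `Θ⁰`. -/
def scalarExtensionAut (E : Set (FreeNonUnitalNonAssocAlgebra ℤ ℕ)) (σ : RingAut k) :
    CategoryAut (FreeCat k E) where
  hom := (scalarExtension E (σ : k →+* k)).toCatHom
  inv := (scalarExtension E (RingEquiv.symm σ : k →+* k)).toCatHom
  hom_inv_id :=
    congrArg Functor.toCatHom (scalarExtension_comp_eq_id (RingEquiv.symm_apply_apply σ))
  inv_hom_id :=
    congrArg Functor.toCatHom (scalarExtension_comp_eq_id (RingEquiv.apply_symm_apply σ))

section Automorphisms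

variable [Infinite k] [NeZero (2 : k)] [Nontrivial (FreeAlg k E Unit)]

theorem exists_semilinearIso_categoryAut (Φ : CategoryAut (FreeCat k E)) :
    ∃ σ : RingAut k, Nonempty (SemilinearIso σ Φ.hom.toFunctor) :=
  let G : FreeCat k E ⥤ FreeCat k E := Φ.hom.toFunctor
  have : G.IsEquivalence := (Cat.equivOfIso Φ).isEquivalence_functor
  exists_semilinearIso G

/-- The homomorphism `Aut Θ⁰ → Aut k` which sends `Φ` to the automorphism `σ` for which `Φ` is
`σ`-semilinear. -/
def scalarAut (k : Type u) [Field k] (E : Set (FreeNonUnitalNonAssocAlgebra ℤ ℕ)) [Infinite k]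
    [NeZero (2 : k)] [Nontrivial (FreeAlg k E Unit)] : CategoryAut (FreeCat k E) →* RingAut k :=
  MonoidHom.mk' (fun Φ => (exists_semilinearIso_categoryAut Φ).choose) fun Φ Ψ => by
    have hspec (Φ : CategoryAut (FreeCat k E)) := (exists_semilinearIso_categoryAut Φ).choose_spec
    exact (hspec (Φ * Ψ)).some.ringEquiv_unique ((hspec Ψ).some.trans (hspec Φ).some)

theorem scalarAut_eq_iff {Φ : CategoryAut (FreeCat k E)} {σ : RingAut k} :
    scalarAut k E Φ = σ ↔ Nonempty (SemilinearIso σ Φ.hom.toFunctor) := by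
  have hΦ : Nonempty (SemilinearIso (scalarAut k E Φ) Φ.hom.toFunctor) :=
    (exists_semilinearIso_categoryAut Φ).choose_spec
  exact ⟨fun h => h ▸ hΦ, fun ⟨t⟩ => hΦ.some.ringEquiv_unique t⟩

theorem scalarAut_surjective : Function.Surjective (scalarAut k E) := fun σ =>
  ⟨scalarExtensionAut E σ, scalarAut_eq_iff.2 ⟨scalarExtensionIso E σ⟩⟩

theorem ker_scalarAut : (scalarAut k E).ker = innerAut (FreeCat k E) :=
  Subgroup.ext fun _ => scalarAut_eq_iff.trans
    ⟨fun ⟨t⟩ => ⟨t.toNatIso⟩, fun ⟨i⟩ => ⟨SemilinearIso.ofNatIso i⟩⟩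

end Automorphisms

end Category

end AnticommVariety

open AnticommVariety in
theorem mainTheorem5_general {k : Type u} [Field k] [Infinite k] [NeZero (2 : k)]
    (E : Set (FreeNonUnitalNonAssocAlgebra ℤ ℕ)) {A : Type*} [NonUnitalNonAssocRing A]
    [Module k A] [IsScalarTower k A A] [SMulCommClass k A A] [Nontrivial A] (hA : InVariety E A) :
    Nonempty (CategoryAut (FreeCat k E) ⧸ innerAut (FreeCat k E) ≃* RingAut k) := by
  have : Nontrivial (FreeAlg k E Unit) := ⟨_, 0, of_ne_zero_of_inVariety hA ()⟩
  exact ⟨(QuotientGroup.quotientMulEquivOfEq ker_scalarAut.symm).trans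
    (QuotientGroup.quotientKerEquivOfSurjective (scalarAut k E) scalarAut_surjective)⟩

end

theorem mainTheorem5 {k : Type u} [Field k] [CharZero k]
    (E : Set (FreeNonUnitalNonAssocAlgebra ℤ ℕ))
    (hE : ∃ (A : Type u) (_ : NonUnitalNonAssocRing A) (_ : Module k A)
      (_ : IsScalarTower k A A) (_ : SMulCommClass k A A),
      AnticommVariety.InVariety E A ∧ Nontrivial A) :
    Nonempty
      (CategoryAut (AnticommVariety.FreeCat k E) ⧸ innerAut (AnticommVariety.FreeCat k E) ≃*
        RingAut k) := by
  obtain ⟨A, _, _, _, _, hA, _⟩ := hE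
  exact mainTheorem5_general E hA
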